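/- Let $X$ be a finite set with symmetric conductances $C_{x,y}=C_{y,x}\ge 0$, $C_{x,x}=0$, and a killing measure $\kappa\ge 0$; put $\lambda_x=\kappa_x+\sum_y C_{x,y}$ (assumed positive), $P^x_y=C_{x,y}/\lambda_x$, and let $$e(z)=\tfrac12\sum_{x,y}C_{x,y}|z^x-z^y|^2+\sum_x\kappa_x|z^x|^2$$ be the associated energy, assumed to have a mass gap: $e(z)\ge\varepsilon\sum_x\lambda_x|z^x|^2$ for some $\varepsilon>0$ and all $z:X\to\mathbb C$. Let $\mu$ be the loop measure of the continuous-time chain with transition matrix $P$ and exponential holding times of parameter one, i.e. the image of $\mu_0=\sum_x\int_0^\infty \frac1t\,\mathbb P^{x,x}_t\,dt$ on loops (based loops up to shift of time), where $\mathbb P_t^{x,x}$ is the unnormalized law of the chain on closed paths of duration $t$ from $x$ to $x$. For $\alpha>0$ let $\mathcal L_\alpha$ be a Poisson point process of loops with intensity $\alpha\mu$. For $D\subset X$, the restriction $\mathcal L_\alpha|_D$ is the configuration of the loops of $\mathcal L_\alpha$ contained in $D$, and the trace $\mathcal L_\alpha^{\{D\}}$ is the configuration of the traces on $D$ (time spent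 outside $D$ erased) of the loops of $\mathcal L_\alpha$ which visit $D$. Suppose $X=X^+\cup X^-$, and let $\rho$ be an involution of $X$ such that $\rho(X^+)=X^-$, $\rho(x)=x$ for every $x\in X^0=X^+\cap X^-$, and $e(z\circ\rho)=e(z)$ for all $z$. Write $(F\circ\rho)(\eta)=F(\rho\eta)$ for functions $F$ of a configuration $\eta$ of loops. (i) Let $\Lambda$ be the configuration induced by $\mathcal L_\alpha$ on $X^0$, that is, either $\mathcal L_\alpha|_{X^0}$ or $\mathcal L_\alpha^{\{X^0\}}$. For every measurable complex function $F$ of loop configurations such that $F(\mathcal L_\alpha|_{X^+})$ is integrable, $F\circ\rho(\mathcal L_\alpha|_{X^-})$ is integrable and, almost surely, $$E\big(F(\mathcal L_\alpha|_{X^+})\,\big|\,\Lambda\big)=E\big(F\circ\rho(\mathcal L_\alpha|_{X^-})\,\big|\,\Lambda\big).$$ The same holds with the traces $\mathcal L_\alpha^{\{X^+\}},\mathcal L_\alpha^{\{X^-\}}$ in place of the restrictions $\mathcal L_\alpha|_{X^+},\mathcal L_\alpha|_{X^-}$ (again for both choices of $\Lambda$). (ii) (Reflection positivity.) For every measurable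 complex function $F$ of loop configurations such that $F(\mathcal L_\alpha|_{X^+})\,\overline{F\circ\rho(\mathcal L_\alpha|_{X^-})}$ is integrable (in particular whenever $F(\mathcal L_\alpha|_{X^+})$ is square integrable), $$E\Big(F(\mathcal L_\alpha|_{X^+})\,\overline{F\circ\rho(\mathcal L_\alpha|_{X^-})}\Big)\ \text{ is real and }\ \ge 0 .$$ -/

import Mathlib

open MeasureTheory
open scoped ENNReal NNReal

noncomputable section

/-- The energy of a symmetric Markov chain on a finite space `X`, given by its conductances `C` and
its killing measure `κ`, with a mass gap. -/
structure MarkovEnergy (X : Type*) [Fintype X] where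
  /-- the conductances -/
  C : X → X → ℝ
  /-- the killing measure -/
  κ : X → ℝ
  C_symm : ∀ x y, C x y = C y x
  C_nonneg : ∀ x y, 0 ≤ C x y
  C_diag : ∀ x, C x x = 0
  κ_nonneg : ∀ x, 0 ≤ κ x
  lam_pos : ∀ x, 0 < κ x + ∑ y, C x y
  mass_gap : ∃ ε : ℝ, 0 < ε ∧ ∀ z : X → ℂ,
    ε * ∑ x, (κ x + ∑ y, C x y) * ‖z x‖ ^ 2 ≤
      (1 / 2) * ∑ x, ∑ y, C x y * ‖z x - z y‖ ^ 2 + ∑ x, κ x * ‖z x‖ ^ 2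

namespace MarkovEnergy

variable {X : Type*} [Fintype X] (E : MarkovEnergy X)

/-- The measure `λ_x = κ_x + ∑_y C_{x,y}`. -/
def lam (x : X) : ℝ := E.κ x + ∑ y, E.C x y

/-- The energy `e(z)` of a complex function `z`. -/
def energy (z : X → ℂ) : ℝ :=
  (1 / 2) * ∑ x, ∑ y, E.C x y * ‖z x - z y‖ ^ 2 + ∑ x, E.κ x * ‖z x‖ ^ 2

/-- The (sub-Markovian) transition matrix `P^x_y = C_{x,y} / λ_x`. -/
def P (x y : X) : ℝ := E.C x y / E.lam x

end MarkovEnergy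

/-- Positive durations. -/
abbrev Duration : Type := {t : ℝ // 0 < t}

/-- Lebesgue measure on positive durations. -/
def durationMeasure : Measure Duration := Measure.comap Subtype.val (volume : Measure ℝ)

/-- A based loop is coded by the finite list of its successive positions with the time spent at
each of them. Two codes describe the same loop, that is, the same closed path up to a shift of time,
iff they are related by moving the base point (`rotate`; by cutting a visit in two the base point can
also be moved into the interior of a visit) and by cutting visits in two or merging them (`merge`). -/
inductive LoopStep (X : Type*) : List (X × Duration) → List (X × Duration) → Prop
  | rotate (a : X × Duration) (l : List (X × Duration)) : LoopStep X (a :: l) (l ++ [a])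
  | merge (x : X) (s t : Duration) (l : List (X × Duration)) :
      LoopStep X ((x, s) :: (x, t) :: l) ((x, ⟨s.1 + t.1, add_pos s.2 t.2⟩) :: l)

/-- Loops: based loops up to shift of time. (The class of the empty list is a dummy element which is
not charged by the loop measure.) -/
def Loop (X : Type*) : Type _ := Quot (LoopStep X)

namespace Loop

variable {X : Type*}

/-- The loop with a given code. -/
def mk (l : List (X × Duration)) : Loop X := Quot.mk _ l

/-- A set of loops is measurable iff, for each `n`, so is the set of its codes of length `n`. -/
instance [MeasurableSpace X] : MeasurableSpace (Loop X) :=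
  MeasurableSpace.map
    (fun s : (Σ n : ℕ, (Fin n → X × Duration)) => mk (List.ofFn s.2)) inferInstance

/-- The set of the points visited by a loop. -/
def points : Loop X → Set X :=
  Quot.lift (fun l => {x | ∃ a ∈ l, a.1 = x}) (by
    intro l l' h
    cases h with
    | rotate a l => ext x; simp [or_comm]
    | merge x s t l => ext y; simp)

/-- The image of a loop under a map of the state space. -/
def map (f : X → X) : Loop X → Loop X :=
  Quot.map (List.map (fun a => (f a.1, a.2))) (by
    intro l l' h
    cases h with
    | rotate a l => simpa using LoopStep.rotate (f a.1, a.2) _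
    | merge x s t l => simpa using LoopStep.merge (f x) s t _)

open Classical in
/-- The trace of a loop on `F`: the time spent outside `F` is erased. -/
def trace (F : Set X) : Loop X → Loop X :=
  Quot.lift (fun l => mk (l.filter (fun a => a.1 ∈ F))) (by
    intro l l' h
    cases h with
    | rotate a l =>
      by_cases ha : a.1 ∈ F
      · simp only [List.filter_append, List.filter_cons, List.filter_nil, ha, decide_true, if_true]
        exact Quot.sound (LoopStep.rotate a _)
      · simp [ha]
    | merge x s t l =>
      by_cases hx : x ∈ F
      · simp only [List.filter_cons, hx, decide_true, if_true]
        exact Quot.sound (LoopStep.merge x s t _)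
      · simp [hx])

end Loop

/-- The loop measure `μ`: the image on loops of the measure `μ₀ = ∑_x ∫ (1/t) ℙ_t^{x,x} dt` on based
loops, for the chain which waits an exponential time of parameter one at each point and then jumps
according to `P`. The term of index `k` is the contribution of the based loops with `k` jumps,
visiting `x 0, …, x k` (with `x k = x 0`) for the times `τ 0, …, τ k` of sum `t`. -/
def MarkovEnergy.loopMeasure {X : Type*} [Fintype X] [MeasurableSpace X] (E : MarkovEnergy X) :
    Measure (Loop X) :=
  open Classical in
  Measure.sum fun k : ℕ =>
    ∑ x : Fin (k + 1) → X,
      (if x 0 = x (Fin.last k) then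
          ENNReal.ofReal (∏ i : Fin k, E.P (x i.castSucc) (x i.succ)) else 0) •
        Measure.map (fun τ : Fin (k + 1) → Duration => Loop.mk (List.ofFn fun i => (x i, τ i)))
          ((Measure.pi fun _ : Fin (k + 1) => durationMeasure).withDensity fun τ =>
            ENNReal.ofReal (Real.exp (-∑ i, (τ i).1) / ∑ i, (τ i).1))

/-- The Poisson distribution of parameter `r ∈ [0, ∞]`; it is the unit mass at `∞` if `r = ∞`. -/
def poissonLaw (r : ℝ≥0∞) : Measure ℝ≥0∞ :=
  if r = ∞ then Measure.dirac ∞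
  else Measure.map (fun n : ℕ => (n : ℝ≥0∞)) (ProbabilityTheory.poissonMeasure r.toNNReal)

/-- `N` is a Poisson point process with intensity `ν` under `Pr`; the configuration `N ω` is identified
with the counting measure of its points (with multiplicity). -/
structure IsPoissonProcess {Ω S : Type*} [MeasurableSpace Ω] [MeasurableSpace S]
    (N : Ω → Measure S) (ν : Measure S) (Pr : Measure Ω) : Prop where
  measurable : Measurable N
  configuration : ∀ᵐ ω ∂Pr, ∃ (I : Set ℕ) (p : I → S),
    N ω = Measure.sum fun i => Measure.dirac (p i)
  law : ∀ A : Set S, MeasurableSet A → Measure.map (fun ω => N ω A) Pr = poissonLaw (ν A)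
  indep : ∀ (n : ℕ) (A : Fin n → Set S), (∀ i, MeasurableSet (A i)) →
    (Pairwise fun i j => Disjoint (A i) (A j)) → ProbabilityTheory.iIndepFun (fun i ω => N ω (A i)) Pr

/-- Configurations of loops, identified with their counting measures, with the `σ`-field generated
by the numbers of loops in the measurable sets of loops. -/
abbrev LoopConfig (X : Type*) [MeasurableSpace X] : Type _ := Measure (Loop X)

namespace LoopConfig

variable {X : Type*} [MeasurableSpace X]

/-- The restriction of a configuration to `D`: its loops contained in `D`. -/
def restrictTo (D : Set X) (η : LoopConfig X) : LoopConfig X :=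
  Measure.restrict η {l | l.points ⊆ D}

/-- The trace of a configuration on `D`: the traces on `D` of its loops which visit `D`. -/
def traceOn (D : Set X) (η : LoopConfig X) : LoopConfig X :=
  Measure.map (Loop.trace D) (Measure.restrict η {l | (l.points ∩ D).Nonempty})

/-- The image of a configuration under a map of the state space. -/
def image (f : X → X) (η : LoopConfig X) : LoopConfig X :=
  Measure.map (Loop.map f) η

end LoopConfig

end

/-! The reflection is a symmetry of the loop process. Evaluating the energy at indicators of one and
of two points recovers `lam` and `C`, so an energy-preserving involution preserves `P`
(`P_comp_eq`), hence the loop measure (`loopMeasure_map`). The reflected process is then Poisson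
with the same intensity, and a Poisson process is determined in law by its intensity
(`IsPoissonProcess.map_eq`).

(i) Localizing the reflected configuration to `Xp` gives the reflection of the localization to `Xm`,
while the configuration `Λ` induced on `Xp ∩ Xm` is unchanged because `ρ` fixes these points.
Equality in law of the process and its reflection thus gives equal conditional expectations
(`condExp_eq_of_map_eq`).

(ii) The loops in `Xp ∩ Xm`, the other loops in `Xp` and the other loops in `Xm` form independent
configurations `U`, `V`, `W`, and the reflection `V'` of `W` has the law of `V`. The integral is `E
(G (U, V) * conj (G (U, V')))`, that is, the mean over `U` of the squared modulus of the mean of `G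
(U, ·)` (`integral_mul_conj_nonneg`). -/

/-- The cell of `S` of the points which belong to exactly the sets of the family `A` selected by
`s`. -/
def cell {S J : Type*} (A : J → Set S) (s : J → Prop) : Set S := {x | (fun j => x ∈ A j) = s}

theorem disjoint_cell {S J : Type*} (A : J → Set S) {s t : J → Prop} (h : s ≠ t) :
    Disjoint (cell A s) (cell A t) :=
  Set.disjoint_left.2 fun _ hs ht => h (hs.symm.trans ht)

/-! ### Random measures and their finite-dimensional laws -/

section MeasureValued

variable {Ω S : Type*} [MeasurableSpace Ω] [MeasurableSpace S]

open ProbabilityTheory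

/-- A measure on `S`, seen as a function on the measurable sets of `S`. -/
noncomputable def measureCoords (η : Measure S) (A : {A : Set S // MeasurableSet A}) : ℝ≥0∞ := η A.1

theorem measurable_measureCoords : Measurable (measureCoords (S := S)) :=
  measurable_pi_lambda _ fun A => Measure.measurable_coe A.2

/-- Makes a random measure a process indexed by the measurable sets, so that laws and independence
transfer from the product σ-field. -/
theorem comap_measureCoords :
    MeasurableSpace.comap (measureCoords (S := S)) inferInstance = Measure.instMeasurableSpace := by
  refine le_antisymm measurable_measureCoords.comap_le ?_
  refine iSup₂_le fun s hs => ?_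
  rw [← measurable_iff_comap_le, ← BorelSpace.measurable_eq (α := ℝ≥0∞)]
  exact (measurable_pi_apply (⟨s, hs⟩ : {A : Set S // MeasurableSet A})).comp
    (comap_measurable (measureCoords (S := S)))

/-- The law of a random measure is determined by the joint laws of its values on finitely many
measurable sets. -/
theorem map_eq_of_map_finset_eq {Pr : Measure Ω} [IsFiniteMeasure Pr] {N N' : Ω → Measure S}
    (hN : Measurable N) (hN' : Measurable N')
    (h : ∀ J : Finset {A : Set S // MeasurableSet A},
      Pr.map (fun ω (A : J) => N ω A.1.1) = Pr.map (fun ω (A : J) => N' ω A.1.1)) :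
    Pr.map N = Pr.map N' := by
  have key : Pr.map (fun ω A => measureCoords (N ω) A) =
      Pr.map (fun ω A => measureCoords (N' ω) A) :=
    (map_eq_iff_forall_finset_map_restrict_eq
      (X := fun A ω => measureCoords (N ω) A) (Y := fun A ω => measureCoords (N' ω) A)
      (measurable_measureCoords.comp hN).aemeasurable
      (measurable_measureCoords.comp hN').aemeasurable).2 fun J => h J
  ext T hT
  rw [← comap_measureCoords] at hT
  obtain ⟨T', hT', rfl⟩ := hT
  have := (Measure.map_apply (measurable_measureCoords.comp hN) hT').symm.trans
    ((congrArg (fun m => m T') key).trans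
      (Measure.map_apply (measurable_measureCoords.comp hN') hT'))
  rwa [Measure.map_apply hN (measurable_measureCoords hT'),
    Measure.map_apply hN' (measurable_measureCoords hT')]

/-- Two random measures are independent as soon as their values on finitely many measurable sets
are. -/
theorem indepFun_of_indepFun_finset {Pr : Measure Ω} [IsProbabilityMeasure Pr]
    {N N' : Ω → Measure S} (hN : Measurable N) (hN' : Measurable N')
    (h : ∀ I J : Finset {A : Set S // MeasurableSet A},
      IndepFun (fun ω (A : I) => N ω A.1.1) (fun ω (A : J) => N' ω A.1.1) Pr) :
    IndepFun N N' Pr := by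
  have key : IndepFun (fun ω A => measureCoords (N ω) A) (fun ω A => measureCoords (N' ω) A) Pr :=
    IndepFun.process_indepFun_process
      (X := fun A ω => measureCoords (N ω) A) (Y := fun A ω => measureCoords (N' ω) A)
      (fun A => (Measure.measurable_coe A.2).comp hN)
      (fun A => (Measure.measurable_coe A.2).comp hN') h
  rw [IndepFun_iff_Indep] at key ⊢
  rw [← comap_measureCoords, MeasurableSpace.comap_comp, MeasurableSpace.comap_comp]
  exact key

theorem measurable_restrict_measure {T : Set S} (hT : MeasurableSet T) :
    Measurable fun η : Measure S => η.restrict T := by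
  refine Measure.measurable_of_measurable_coe _ fun A hA => ?_
  simp_rw [Measure.restrict_apply hA]
  exact Measure.measurable_coe (hA.inter hT)

theorem measurableSet_cell {J : Type*} [Finite J] {A : J → Set S} (hA : ∀ j, MeasurableSet (A j))
    (s : J → Prop) : MeasurableSet (cell A s) := by
  have : cell A s = ⋂ j, {x | x ∈ A j ↔ s j} := by
    ext x; simp [cell, funext_iff]
  rw [this]
  refine MeasurableSet.iInter fun j => ?_
  by_cases hs : s j
  · simpa [hs] using hA j
  · simpa only [hs, iff_false] using! (hA j).compl

-- Overlapping sets are unions of disjoint cells. Values on them are sums of values on cells, to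
-- which Poisson independence applies; only sums occur, so infinite values do no harm.
open Classical in
theorem measure_eq_sum_cell {J : Type*} [Finite J] [Fintype (J → Prop)]
    {A : J → Set S}    (hA : ∀ j, MeasurableSet (A j)) (η : Measure S) {T : Set S} (hT : MeasurableSet T) (j : J) :
    η (A j ∩ T) = ∑ s : J → Prop, if s j then η (cell A s ∩ T) else 0 := by
  rw [← Finset.sum_filter,
    ← measure_biUnion_finset₀
      (fun s _ t _ hst => ((disjoint_cell A hst).mono Set.inter_subset_left
        Set.inter_subset_left).aedisjoint)]
  · congr 1
    ext x
    simp only [Set.mem_inter_iff, Finset.mem_filter, Finset.mem_univ, true_and, Set.mem_iUnion,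
      exists_prop, cell, Set.mem_ofPred_eq]
    constructor
    · rintro ⟨h, hT⟩
      exact ⟨_, h, rfl, hT⟩
    · rintro ⟨s, hs, rfl, hT⟩
      exact ⟨hs, hT⟩
  · exact fun s _ => ((measurableSet_cell hA s).inter hT).nullMeasurableSet

end MeasureValued

/-! ### Poisson processes: uniqueness in law, images, independence of restrictions -/

namespace IsPoissonProcess

open ProbabilityTheory

variable {Ω S : Type*} [MeasurableSpace Ω] [MeasurableSpace S] {N : Ω → Measure S}
  {ν : Measure S} {Pr : Measure Ω}

theorem iIndepFun_of_disjoint (h : IsPoissonProcess N ν Pr) {κ : Type*} [Fintype κ]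
    {B : κ → Set S} (hB : ∀ k, MeasurableSet (B k))
    (hd : Pairwise fun k l => Disjoint (B k) (B l)) :
    iIndepFun (fun k ω => N ω (B k)) Pr := by
  let e := Fintype.equivFin κ
  have := h.indep (Fintype.card κ) (fun i => B (e.symm i)) (fun i => hB _)
    (fun i j hij => hd (e.symm.injective.ne hij))
  simpa using this.precomp e.injective

theorem map_pi (h : IsPoissonProcess N ν Pr) [IsProbabilityMeasure Pr] {κ : Type*} [Fintype κ]
    {B : κ → Set S} (hB : ∀ k, MeasurableSet (B k))
    (hd : Pairwise fun k l => Disjoint (B k) (B l)) :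
    Pr.map (fun ω k => N ω (B k)) = Measure.pi fun k => poissonLaw (ν (B k)) := by
  refine ((iIndepFun_iff_map_fun_eq_pi_map
    (fun k => ((Measure.measurable_coe (hB k)).comp h.measurable).aemeasurable)).1
    (h.iIndepFun_of_disjoint hB hd)).trans ?_
  congr 1
  funext k
  exact h.law _ (hB k)

/-- The values on finitely many sets are a fixed function `g` of the values on their cells, whose
joint law is a product of Poisson laws depending on `ν` alone. -/
theorem map_eq [IsProbabilityMeasure Pr] {N' : Ω → Measure S} (h : IsPoissonProcess N ν Pr)
    (h' : IsPoissonProcess N' ν Pr) : Pr.map N = Pr.map N' := by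
  classical
  refine map_eq_of_map_finset_eq h.measurable h'.measurable fun J => ?_
  let A : J → Set S := fun j => j.1.1
  have hA : ∀ j, MeasurableSet (A j) := fun j => j.1.2
  let g : ((J → Prop) → ℝ≥0∞) → J → ℝ≥0∞ := fun v j => ∑ s, if s j then v s else 0
  have hg : Measurable g := by
    refine measurable_pi_lambda _ fun j => Finset.measurable_sum _ fun s _ => ?_
    by_cases hs : s j
    · simpa [hs] using measurable_pi_apply s
    · simp [hs]
  have key : ∀ M : Ω → Measure S, IsPoissonProcess M ν Pr →
      Pr.map (fun ω (j : J) => M ω j.1.1) =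
        (Measure.pi fun s => poissonLaw (ν (cell A s))).map g := by
    intro M hM
    have hcells : Measurable fun ω s => M ω (cell A s) := measurable_pi_lambda _ fun s =>
      (Measure.measurable_coe (measurableSet_cell hA s)).comp hM.measurable
    rw [← hM.map_pi (measurableSet_cell hA) (fun _ _ => disjoint_cell A),
      Measure.map_map hg hcells]
    congr 1
    funext ω j
    simpa [g, A] using measure_eq_sum_cell hA (M ω) .univ j
  rw [key N h, key N' h']

theorem map {S' : Type*} [MeasurableSpace S'] (h : IsPoissonProcess N ν Pr) {g : S → S'}
    (hg : Measurable g) : IsPoissonProcess (fun ω => (N ω).map g) (ν.map g) Pr where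
  measurable := (Measure.measurable_map g hg).comp h.measurable
  configuration := by
    filter_upwards [h.configuration] with ω ⟨I, p, hp⟩
    refine ⟨I, g ∘ p, ?_⟩
    rw [hp, Measure.map_sum hg.aemeasurable]
    simp [Measure.map_dirac' hg]
  law A hA := by
    simp_rw [Measure.map_apply hg hA]
    exact h.law _ (hg hA)
  indep n A hA hd := by
    simp_rw [fun i ω => Measure.map_apply (μ := N ω) hg (hA i)]
    exact h.indep n _ (fun i => hg (hA i)) fun i j hij => (hd hij).preimage g

theorem indepFun_restrict (h : IsPoissonProcess N ν Pr) [IsProbabilityMeasure Pr] {T T' : Set S}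
    (hT : MeasurableSet T) (hT' : MeasurableSet T') (hd : Disjoint T T') :
    IndepFun (fun ω => (N ω).restrict T) (fun ω => (N ω).restrict T') Pr := by
  classical
  refine indepFun_of_indepFun_finset ((measurable_restrict_measure hT).comp h.measurable)
    ((measurable_restrict_measure hT').comp h.measurable) fun I J => ?_
  let A : I → Set S := fun j => j.1.1
  have hA : ∀ j, MeasurableSet (A j) := fun j => j.1.2
  let A' : J → Set S := fun j => j.1.1
  have hA' : ∀ j, MeasurableSet (A' j) := fun j => j.1.2
  -- Cells inside `T` and cells inside `T'` together form one disjoint family; its two blocks are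
  -- independent and determine the two restrictions.
  let B : (I → Prop) ⊕ (J → Prop) → Set S :=
    Sum.elim (fun s => cell A s ∩ T) (fun s => cell A' s ∩ T')
  have hB : ∀ k, MeasurableSet (B k) := by
    rintro (s | s)
    · exact (measurableSet_cell hA s).inter hT
    · exact (measurableSet_cell hA' s).inter hT'
  have hBd : Pairwise fun k l => Disjoint (B k) (B l) := by
    rintro (s | s) (t | t) hst
    · exact (disjoint_cell A (by simpa using hst)).mono Set.inter_subset_left Set.inter_subset_left
    · exact hd.mono Set.inter_subset_right Set.inter_subset_right
    · exact hd.symm.mono Set.inter_subset_right Set.inter_subset_right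
    · exact (disjoint_cell A' (by simpa using hst)).mono Set.inter_subset_left
        Set.inter_subset_left
  have hi := (h.iIndepFun_of_disjoint hB hBd).indepFun_finset
    (Finset.univ.map Function.Embedding.inl) (Finset.univ.map Function.Embedding.inr)
    (by simp [Finset.disjoint_left])
    (fun k => (Measure.measurable_coe (hB k)).comp h.measurable)
  let g : ((k : (Finset.univ.map Function.Embedding.inl : Finset ((I → Prop) ⊕ (J → Prop)))) →
      ℝ≥0∞) → I → ℝ≥0∞ := fun v j => ∑ s : I → Prop, if s j then v ⟨.inl s, by simp⟩ else 0
  let g' : ((k : (Finset.univ.map Function.Embedding.inr : Finset ((I → Prop) ⊕ (J → Prop)))) →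
      ℝ≥0∞) → J → ℝ≥0∞ := fun v j => ∑ s : J → Prop, if s j then v ⟨.inr s, by simp⟩ else 0
  have hg : Measurable g := by
    refine measurable_pi_lambda _ fun j => Finset.measurable_sum _ fun s _ => ?_
    by_cases hs : s j
    · simpa [hs] using measurable_pi_apply _
    · simp [hs]
  have hg' : Measurable g' := by
    refine measurable_pi_lambda _ fun j => Finset.measurable_sum _ fun s _ => ?_
    by_cases hs : s j
    · simpa [hs] using measurable_pi_apply _
    · simp [hs]
  convert hi.comp hg hg' using 1
  · funext ω j
    rw [Measure.restrict_apply (hA j)]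
    simpa [g, B] using measure_eq_sum_cell hA (N ω) hT j
  · funext ω j
    rw [Measure.restrict_apply (hA' j)]
    simpa [g', B] using measure_eq_sum_cell hA' (N ω) hT' j

end IsPoissonProcess

/-! ### Two consequences of equality in law -/

section Law

open ProbabilityTheory

/-- If `N` and `N'` have the same law and `Λ ∘ N = Λ ∘ N'`, then `G ∘ N` and `G ∘ N'` have the same
conditional expectation given `Λ ∘ N`. -/
theorem condExp_eq_of_map_eq {Ω T T' : Type*} [MeasurableSpace Ω] [MeasurableSpace T]
    [MeasurableSpace T'] {Pr : Measure Ω} [IsFiniteMeasure Pr] {N N' : Ω → T}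
    (hN : Measurable N) (hN' : Measurable N') (h : Pr.map N = Pr.map N')
    {Λ : T → T'} (hΛ : Measurable Λ) (hΛN : ∀ ω, Λ (N' ω) = Λ (N ω))
    {G : T → ℂ} (hG : Measurable G) (hint : Integrable (fun ω => G (N ω)) Pr) :
    Integrable (fun ω => G (N' ω)) Pr ∧
      Pr[fun ω => G (N ω) | MeasurableSpace.comap (fun ω => Λ (N ω)) inferInstance] =ᵐ[Pr]
        Pr[fun ω => G (N' ω) | MeasurableSpace.comap (fun ω => Λ (N ω)) inferInstance] := by
  have hint' : Integrable (fun ω => G (N' ω)) Pr :=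
    (integrable_map_measure (f := N') hG.aestronglyMeasurable hN'.aemeasurable).1
      (h ▸ (integrable_map_measure (f := N) hG.aestronglyMeasurable hN.aemeasurable).2 hint)
  refine ⟨hint', ?_⟩
  have hm : MeasurableSpace.comap (fun ω => Λ (N ω)) inferInstance ≤ _ := (hΛ.comp hN).comap_le
  refine ae_eq_condExp_of_forall_setIntegral_eq hm hint'
    (fun s _ _ => integrable_condExp.integrableOn) ?_
    stronglyMeasurable_condExp.aestronglyMeasurable
  rintro s hs -
  rw [setIntegral_condExp hm hint hs]
  obtain ⟨A, hA, rfl⟩ := hs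
  have e1 := setIntegral_map (μ := Pr) (hΛ hA) hG.aestronglyMeasurable hN.aemeasurable
  have e2 := setIntegral_map (μ := Pr) (hΛ hA) hG.aestronglyMeasurable hN'.aemeasurable
  rw [← h, e1] at e2
  -- The conditioning event is the same whether read through `N` or `N'`.
  have : N' ⁻¹' (Λ ⁻¹' A) = (fun ω => Λ (N ω)) ⁻¹' A := by
    ext ω; simp [hΛN]
  rw [this] at e2
  exact e2

/-- Reflection positivity for conditionally independent copies: if `U`, `V`, `V'` are independent
and `V`, `V'` have the same law, then `E (G (U, V) * conj (G (U, V')))` is real and nonnegative. -/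
theorem integral_mul_conj_nonneg {Ω T : Type*} [MeasurableSpace Ω] [MeasurableSpace T]
    {Pr : Measure Ω} [IsProbabilityMeasure Pr] {U V V' : Ω → T} (hU : Measurable U)
    (hV : Measurable V) (hV' : Measurable V') (hUV : IndepFun U (fun ω => (V ω, V' ω)) Pr)
    (hVV' : IndepFun V V' Pr) (hlaw : Pr.map V' = Pr.map V) {G : T × T → ℂ} (hG : Measurable G)
    (hint : Integrable (fun ω => G (U ω, V ω) * (starRingEnd ℂ) (G (U ω, V' ω))) Pr) :
    (∫ ω, G (U ω, V ω) * (starRingEnd ℂ) (G (U ω, V' ω)) ∂Pr).im = 0 ∧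
      0 ≤ (∫ ω, G (U ω, V ω) * (starRingEnd ℂ) (G (U ω, V' ω)) ∂Pr).re := by
  let Z : Ω → T × T × T := fun ω => (U ω, V ω, V' ω)
  have hZ : Measurable Z := hU.prodMk (hV.prodMk hV')
  have hZlaw : Pr.map Z = (Pr.map U).prod ((Pr.map V).prod (Pr.map V)) := by
    rw [(indepFun_iff_map_prod_eq_prod_map_map hU.aemeasurable
      (hV.prodMk hV').aemeasurable).1 hUV,
      (indepFun_iff_map_prod_eq_prod_map_map hV.aemeasurable hV'.aemeasurable).1 hVV', hlaw]
  have := Measure.isProbabilityMeasure_map (μ := Pr) hU.aemeasurable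
  have := Measure.isProbabilityMeasure_map (μ := Pr) hV.aemeasurable
  let H : T × T × T → ℂ := fun p => G (p.1, p.2.1) * (starRingEnd ℂ) (G (p.1, p.2.2))
  have hH : Measurable H := by
    refine Measurable.mul (hG.comp (by fun_prop)) ?_
    exact (Complex.continuous_conj.measurable).comp (hG.comp (by fun_prop))
  have hHint : Integrable H ((Pr.map U).prod ((Pr.map V).prod (Pr.map V))) := by
    rw [← hZlaw]
    exact (integrable_map_measure hH.aestronglyMeasurable hZ.aemeasurable).2 hint
  have e : ∫ ω, G (U ω, V ω) * (starRingEnd ℂ) (G (U ω, V' ω)) ∂Pr =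
      ((∫ u, ‖∫ v, G (u, v) ∂(Pr.map V)‖ ^ 2 ∂(Pr.map U) : ℝ) : ℂ) := by
    have e1 := integral_map (μ := Pr) hZ.aemeasurable hH.aestronglyMeasurable
    rw [hZlaw, integral_prod _ hHint] at e1
    rw [← integral_complex_ofReal]
    refine e1.symm.trans (integral_congr_ae (.of_forall fun u => ?_))
    simp only [H]
    -- The section `G (u, ·)` need not be integrable here: the product formula holds with the
    -- convention that a divergent integral is `0`.
    rw [integral_prod_mul (fun v => G (u, v)) (fun v => (starRingEnd ℂ) (G (u, v))), integral_conj,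
      Complex.mul_conj, Complex.normSq_eq_norm_sq]
  rw [e]
  exact ⟨Complex.ofReal_im _, by rw [Complex.ofReal_re]; exact integral_nonneg fun _ => by positivity⟩

end Law

/-! ### Loops: images, traces, measurability -/

namespace Loop

variable {X : Type*}

theorem mem_points_mk {l : List (X × Duration)} {x : X} :
    x ∈ (mk l).points ↔ ∃ a ∈ l, a.1 = x := Iff.rfl

theorem points_map (f : X → X) (l : Loop X) : (l.map f).points = f '' l.points := by
  induction l using Quot.ind with
  | mk l =>
    ext x
    change (∃ a ∈ l.map (fun a : X × Duration => (f a.1, a.2)), a.1 = x) ↔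
      ∃ y, (∃ a ∈ l, a.1 = y) ∧ f y = x
    simp

theorem points_trace (D : Set X) (l : Loop X) : (l.trace D).points = l.points ∩ D := by
  classical
  induction l using Quot.ind with
  | mk l =>
    ext x
    change (∃ a ∈ l.filter (fun a : X × Duration => a.1 ∈ D), a.1 = x) ↔
      (∃ a ∈ l, a.1 = x) ∧ x ∈ D
    simp only [List.mem_filter, decide_eq_true_eq]
    constructor
    · rintro ⟨a, ⟨h, hD⟩, rfl⟩
      exact ⟨⟨a, h, rfl⟩, hD⟩
    · rintro ⟨⟨a, h, rfl⟩, hD⟩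
      exact ⟨a, ⟨h, hD⟩, rfl⟩

theorem trace_map (f : X → X) (D : Set X) (l : Loop X) :
    (l.map f).trace D = (l.trace (f ⁻¹' D)).map f := by
  induction l using Quot.ind with
  | mk l => exact congrArg mk List.filter_map

theorem map_eq_self {f : X → X} {l : Loop X} (h : ∀ x ∈ l.points, f x = x) : l.map f = l := by
  induction l using Quot.ind with
  | mk l =>
    refine congrArg mk ?_
    conv_rhs => rw [← List.map_id l]
    refine List.map_congr_left fun a ha => ?_
    exact Prod.ext (h a.1 ⟨a, ha, rfl⟩) rfl

variable [MeasurableSpace X]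

theorem measurableSet_iff {A : Set (Loop X)} :
    MeasurableSet A ↔
      ∀ n, MeasurableSet {s : Fin n → X × Duration | mk (List.ofFn s) ∈ A} :=
  MeasurableSpace.measurableSet_iInf

theorem measurable_mk_ofFn (n : ℕ) :
    Measurable fun s : Fin n → X × Duration => mk (List.ofFn s) :=
  fun _ hA => measurableSet_iff.1 hA n

theorem measurable_iff {Y : Type*} [MeasurableSpace Y] {g : Loop X → Y} :
    Measurable g ↔
      ∀ n, Measurable fun s : Fin n → X × Duration => g (mk (List.ofFn s)) :=
  ⟨fun hg n => hg.comp (measurable_mk_ofFn n), fun h _ hA => measurableSet_iff.2 fun n => h n hA⟩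

theorem measurable_map {f : X → X} (hf : Measurable f) : Measurable (map f) := by
  refine measurable_iff.2 fun n => ?_
  have : (fun s : Fin n → X × Duration => (mk (List.ofFn s)).map f) =
      fun s => mk (List.ofFn fun i => (f (s i).1, (s i).2)) := by
    funext s
    exact congrArg mk List.map_ofFn
  rw [this]
  exact (measurable_mk_ofFn n).comp (by fun_prop)

theorem measurableSet_points_subset {D : Set X} (hD : MeasurableSet D) :
    MeasurableSet {l : Loop X | l.points ⊆ D} := by
  refine measurableSet_iff.2 fun n => ?_
  have : {s : Fin n → X × Duration | mk (List.ofFn s) ∈ {l : Loop X | l.points ⊆ D}} =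
      ⋂ i, {s | (s i).1 ∈ D} := by
    ext s
    simp [Set.subset_def, mem_points_mk]
  rw [this]
  refine MeasurableSet.iInter fun i => ?_
  exact (show Measurable fun s : Fin n → X × Duration => (s i).1 by fun_prop) hD

theorem measurableSet_points_inter_nonempty {D : Set X} (hD : MeasurableSet D) :
    MeasurableSet {l : Loop X | (l.points ∩ D).Nonempty} := by
  convert (measurableSet_points_subset hD.compl).compl using 1
  ext l
  simp [Set.not_subset, Set.Nonempty]

/-- The length of the filtered code varies with the code. For each of the finitely many patterns `q`
of positions lying in `D`, the trace selects the fixed coordinates `L q`. -/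
theorem measurable_trace {D : Set X} (hD : MeasurableSet D) :
    Measurable (trace D) := by
  classical
  refine measurable_iff.2 fun n A hA => ?_
  let L : (Fin n → Prop) → List (Fin n) := fun q => (List.finRange n).filter (fun i => q i)
  have key : (fun s : Fin n → X × Duration => (mk (List.ofFn s)).trace D) ⁻¹' A =
      ⋃ q : Fin n → Prop, {s | ∀ i, (s i).1 ∈ D ↔ q i} ∩
        (fun s => mk (List.ofFn fun j : Fin (L q).length => s ((L q).get j))) ⁻¹' A := by
    have e : ∀ s : Fin n → X × Duration, (mk (List.ofFn s)).trace D =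
        mk (List.ofFn fun j : Fin (L fun i => (s i).1 ∈ D).length =>
          s ((L fun i => (s i).1 ∈ D).get j)) := by
      intro s
      refine congrArg mk ?_
      rw [List.ofFn_eq_map, List.filter_map]
      conv_lhs => rw [← List.ofFn_get (List.filter _ _), List.map_ofFn]
      rfl
    ext s
    simp only [Set.mem_preimage, Set.mem_iUnion, Set.mem_inter_iff, Set.mem_ofPred_eq]
    constructor
    · intro h
      exact ⟨fun i => (s i).1 ∈ D, fun i => Iff.rfl, by rwa [← e]⟩
    · rintro ⟨q, hq, h⟩
      obtain rfl : (fun i => (s i).1 ∈ D) = q := funext fun i => propext (hq i)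
      rwa [e]
  rw [key]
  refine MeasurableSet.iUnion fun q => MeasurableSet.inter ?_ ?_
  · have : {s : Fin n → X × Duration | ∀ i, (s i).1 ∈ D ↔ q i} =
        ⋂ i, {s | (s i).1 ∈ D ↔ q i} := by
      ext s; simp
    rw [this]
    refine MeasurableSet.iInter fun i => ?_
    have hi : MeasurableSet {s : Fin n → X × Duration | (s i).1 ∈ D} :=
      (show Measurable fun s : Fin n → X × Duration => (s i).1 by fun_prop) hD
    by_cases hq : q i
    · simpa only [hq, iff_true] using hi
    · simpa only [hq, iff_false] using! hi.compl
  · exact ((measurable_mk_ofFn _).comp (by fun_prop)) hA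

end Loop

/-! ### Localized configurations under a map of the state space -/

namespace LoopConfig

variable {X : Type*} [MeasurableSpace X]

theorem measurable_image {f : X → X} (hf : Measurable f) : Measurable (image f) :=
  Measure.measurable_map _ (Loop.measurable_map hf)

theorem measurable_restrictTo {D : Set X} (hD : MeasurableSet D) : Measurable (restrictTo D) :=
  measurable_restrict_measure (Loop.measurableSet_points_subset hD)

theorem measurable_traceOn {D : Set X} (hD : MeasurableSet D) : Measurable (traceOn D) :=
  (Measure.measurable_map _ (Loop.measurable_trace hD)).comp
    (measurable_restrict_measure (Loop.measurableSet_points_inter_nonempty hD))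

theorem restrictTo_image {f : X → X} (hf : Measurable f) {D : Set X} (hD : MeasurableSet D)
    (η : LoopConfig X) : restrictTo D (image f η) = image f (restrictTo (f ⁻¹' D) η) := by
  rw [restrictTo, image, Measure.restrict_map (Loop.measurable_map hf)
    (Loop.measurableSet_points_subset hD)]
  unfold image restrictTo
  congr 2
  ext l
  simp [Loop.points_map]

theorem traceOn_image {f : X → X} (hf : Measurable f) {D : Set X} (hD : MeasurableSet D)
    (η : LoopConfig X) : traceOn D (image f η) = image f (traceOn (f ⁻¹' D) η) := by
  have hm := Loop.measurable_map hf
  rw [traceOn, image, Measure.restrict_map hm (Loop.measurableSet_points_inter_nonempty hD),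
    Measure.map_map (Loop.measurable_trace hD) hm, image, traceOn,
    Measure.map_map hm (Loop.measurable_trace (hf hD))]
  have hcomp : Loop.trace D ∘ Loop.map f = Loop.map f ∘ Loop.trace (f ⁻¹' D) :=
    funext fun l => Loop.trace_map f D l
  have hset : Loop.map f ⁻¹' {l | (l.points ∩ D).Nonempty} =
      {l | (l.points ∩ f ⁻¹' D).Nonempty} := by
    ext l
    simp only [Set.mem_preimage, Set.mem_ofPred_eq, Loop.points_map, Set.image_inter_nonempty_iff]
  rw [hcomp, hset]

/-- A map which fixes every point of `D` does not change the configurations of loops in `D`. -/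
theorem image_eq_self {f : X → X} {D : Set X} (hfD : ∀ x ∈ D, f x = x)
    {η : LoopConfig X} (h : ∀ᵐ l ∂η, l.points ⊆ D) : image f η = η := by
  have : Loop.map f =ᵐ[η] id := by
    filter_upwards [h] with l hl using Loop.map_eq_self fun x hx => hfD x (hl hx)
  rw [image, Measure.map_congr this, Measure.map_id]

theorem image_restrictTo_eq_self {f : X → X} {D : Set X} (hD : MeasurableSet D)
    (hfD : ∀ x ∈ D, f x = x) (η : LoopConfig X) :
    image f (restrictTo D η) = restrictTo D η :=
  image_eq_self hfD (ae_restrict_mem (Loop.measurableSet_points_subset hD))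

theorem image_traceOn_eq_self {f : X → X} {D : Set X} (hD : MeasurableSet D)
    (hfD : ∀ x ∈ D, f x = x) (η : LoopConfig X) :
    image f (traceOn D η) = traceOn D η := by
  refine image_eq_self hfD ?_
  rw [traceOn, ae_map_iff (Loop.measurable_trace hD).aemeasurable
    (Loop.measurableSet_points_subset hD)]
  exact .of_forall fun l => by simp [Loop.points_trace]

end LoopConfig

/-! ### Invariance of the transition matrix and of the loop measure -/

namespace MarkovEnergy

variable {X : Type*} [Fintype X] (E : MarkovEnergy X)

/-- Composition with `ρ` permutes the discrete paths `x` with `k` jumps and keeps their weights,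
while the law of the durations does not depend on `x`. -/
theorem loopMeasure_map [MeasurableSpace X] [DiscreteMeasurableSpace X] {ρ : X → X}
    (hρ : Function.Involutive ρ) (hP : ∀ x y, E.P (ρ x) (ρ y) = E.P x y) :
    E.loopMeasure.map (Loop.map ρ) = E.loopMeasure := by
  have hm := Loop.measurable_map (Measurable.of_discrete (f := ρ))
  unfold loopMeasure
  rw [Measure.map_sum hm.aemeasurable]
  congr 1
  funext k
  rw [Measure.map_finset_sum hm.aemeasurable]
  refine Fintype.sum_equiv ((Equiv.refl (Fin (k + 1))).arrowCongr hρ.toPerm) _ _ fun x => ?_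
  have hx : Measurable fun τ : Fin (k + 1) → Duration => Loop.mk (List.ofFn fun i => (x i, τ i)) :=
    (Loop.measurable_mk_ofFn (k + 1)).comp (by fun_prop)
  rw [Measure.map_smul, Measure.map_map hm hx]
  congr 1
  · by_cases h : x 0 = x (Fin.last k)
    · rw [if_pos h]
      refine Eq.trans ?_ (if_pos (congrArg ρ h)).symm
      simp [hP]
    · rw [if_neg h]
      exact (if_neg (hρ.injective.ne h)).symm
  · congr 1
    funext τ
    exact congrArg Loop.mk List.map_ofFn

theorem energy_ofReal (u : X → ℝ) :
    E.energy (fun x => (u x : ℂ)) = ∑ x, E.lam x * u x ^ 2 - ∑ x, ∑ y, E.C x y * (u x * u y) := by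
  have h1 : ∀ x y, E.C x y * ‖(u x : ℂ) - (u y : ℂ)‖ ^ 2 =
      E.C x y * u x ^ 2 + E.C x y * u y ^ 2 - 2 * (E.C x y * (u x * u y)) := by
    intro x y
    rw [← Complex.ofReal_sub, Complex.norm_real, Real.norm_eq_abs, sq_abs]
    ring
  have h2 : ∑ x, ∑ y, E.C x y * u y ^ 2 = ∑ x, ∑ y, E.C x y * u x ^ 2 := by
    rw [Finset.sum_comm]
    exact Finset.sum_congr rfl fun x _ => Finset.sum_congr rfl fun y _ => by rw [E.C_symm]
  simp only [energy, h1, Finset.sum_add_distrib, Finset.sum_sub_distrib, h2, ← Finset.mul_sum,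
    Complex.norm_real, Real.norm_eq_abs, sq_abs, lam, add_mul, Finset.sum_mul]
  ring

theorem energy_single [DecidableEq X] (a : X) :
    E.energy (fun x => ((Pi.single a 1 : X → ℝ) x : ℂ)) = E.lam a := by
  rw [energy_ofReal]
  simp [Pi.single_apply, E.C_diag]

/-- The cross term of the quadratic form isolates `C a b` once `lam` is known. -/
theorem energy_single_add_single [DecidableEq X] {a b : X} (hab : a ≠ b) :
    E.energy (fun x => ((Pi.single a 1 + Pi.single b 1 : X → ℝ) x : ℂ)) =
      E.lam a + E.lam b - 2 * E.C a b := by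
  rw [energy_ofReal]
  have h : ∀ x, ((Pi.single a 1 + Pi.single b 1 : X → ℝ) x) ^ 2 =
      (Pi.single a 1 : X → ℝ) x + (Pi.single b 1 : X → ℝ) x := by
    intro x
    by_cases ha : x = a
    · subst ha
      simp [hab]
    · simp [Pi.single_apply, ha]
  simp only [h, mul_add, Finset.sum_add_distrib]
  simp [Pi.single_apply, E.C_diag, mul_add, Finset.sum_add_distrib, E.C_symm b a]
  ring

/-- The transition matrix is invariant under the involutions which preserve the energy. -/
theorem P_comp_eq {ρ : X → X} (hρ : Function.Involutive ρ)
    (hE : ∀ z : X → ℂ, E.energy (z ∘ ρ) = E.energy z) (x y : X) :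
    E.P (ρ x) (ρ y) = E.P x y := by
  classical
  -- As `ρ` is an involution, it carries the indicator of `a` to that of `ρ a`.
  have hs : ∀ a b, (Pi.single a 1 : X → ℝ) (ρ b) = (Pi.single (ρ a) 1 : X → ℝ) b := by
    intro a b
    simp [Pi.single_apply, hρ.eq_iff]
  have hlam : ∀ a, E.lam (ρ a) = E.lam a := by
    intro a
    rw [← energy_single, ← energy_single, ← hE fun x => ((Pi.single a 1 : X → ℝ) x : ℂ)]
    simp only [Function.comp_def, hs]
  have hC : ∀ a b, E.C (ρ a) (ρ b) = E.C a b := by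
    intro a b
    by_cases hab : a = b
    · simp [hab, E.C_diag]
    · have h := hE fun x => ((Pi.single a 1 + Pi.single b 1 : X → ℝ) x : ℂ)
      rw [E.energy_single_add_single hab] at h
      have h' := E.energy_single_add_single (hρ.injective.ne hab)
      simp only [Function.comp_def, Pi.add_apply, hs] at h h'
      rw [h, hlam, hlam] at h'
      linarith
  rw [P, P, hC, hlam]

end MarkovEnergy

/-! ### Reflection positivity for loop configurations -/

namespace LoopConfig

open ProbabilityTheory

variable {X : Type*} [MeasurableSpace X] [DiscreteMeasurableSpace X]
  {Ω : Type*} [MeasurableSpace Ω] {Pr : Measure Ω} [IsProbabilityMeasure Pr]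
  {Xp Xm : Set X} {ρ : X → X} {N : Ω → LoopConfig X} {ν : Measure (Loop X)}

/-- Reflection positivity of a Poisson process of loops whose law is invariant under the
reflection `ρ`. -/
theorem reflection_positivity (hρXp : ρ ⁻¹' Xp = Xm) (hfix : ∀ x ∈ Xp ∩ Xm, ρ x = x)
    (hX0 : ρ ⁻¹' (Xp ∩ Xm) = Xp ∩ Xm) (hN : IsPoissonProcess N ν Pr)
    (hlaw : Pr.map (fun ω => image ρ (N ω)) = Pr.map N) {F : LoopConfig X → ℂ}
    (hF : Measurable F)
    (hint : Integrable (fun ω => F (restrictTo Xp (N ω)) *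
      (starRingEnd ℂ) (F (image ρ (restrictTo Xm (N ω))))) Pr) :
    (∫ ω, F (restrictTo Xp (N ω)) *
      (starRingEnd ℂ) (F (image ρ (restrictTo Xm (N ω)))) ∂Pr).im = 0 ∧
    0 ≤ (∫ ω, F (restrictTo Xp (N ω)) *
      (starRingEnd ℂ) (F (image ρ (restrictTo Xm (N ω)))) ∂Pr).re := by
  have hm := Loop.measurable_map (Measurable.of_discrete (f := ρ))
  -- `T` holds the loops common to both sides; `Tp` and `Tm` are the remaining ones on each side,
  -- disjoint and exchanged by `ρ`.
  let T : Set (Loop X) := {l | l.points ⊆ Xp ∩ Xm}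
  let Tp : Set (Loop X) := {l | l.points ⊆ Xp} \ T
  let Tm : Set (Loop X) := {l | l.points ⊆ Xm} \ T
  have hT : MeasurableSet T := Loop.measurableSet_points_subset .of_discrete
  have hTp : MeasurableSet Tp := (Loop.measurableSet_points_subset .of_discrete).diff hT
  have hTm : MeasurableSet Tm := (Loop.measurableSet_points_subset .of_discrete).diff hT
  have hd : Disjoint Tp Tm :=
    Set.disjoint_left.2 fun l hp hm => hp.2 (Set.subset_inter hp.1 hm.1)
  have hdT : Disjoint T (Tp ∪ Tm) :=
    Set.disjoint_left.2 fun l h h' => h'.elim (fun h' => h'.2 h) fun h' => h'.2 h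
  have hpT : ∀ η : LoopConfig X, restrictTo Xp η = η.restrict T + η.restrict Tp := by
    intro η
    rw [← Measure.restrict_union (hdT.mono_right Set.subset_union_left) hTp]
    exact congrArg η.restrict (Set.union_sdiff_cancel
      fun l hl => hl.trans Set.inter_subset_left).symm
  have hpre : Loop.map ρ ⁻¹' Tp = Tm := by
    ext l
    simp only [Tp, Tm, T, Set.mem_preimage, Set.mem_sdiff, Set.mem_ofPred_eq, Loop.points_map,
      Set.image_subset_iff, hρXp, hX0]
  have hmT : ∀ η : LoopConfig X, image ρ (restrictTo Xm η) =
      η.restrict T + (η.restrict Tm).map (Loop.map ρ) := by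
    intro η
    -- Decompose the reflected configuration as in `hpT`: its part in `T` is fixed, and its part in
    -- `Tp` comes from `Tm`.
    rw [← hρXp, ← restrictTo_image .of_discrete .of_discrete, hpT, ← hpre]
    congr 1
    · change restrictTo (Xp ∩ Xm) (image ρ η) = restrictTo (Xp ∩ Xm) η
      rw [restrictTo_image .of_discrete .of_discrete, hX0,
        image_restrictTo_eq_self .of_discrete hfix]
    · exact Measure.restrict_map hm hTp
  simp only [hpT, hmT] at hint ⊢
  have hres {A : Set (Loop X)} (hA : MeasurableSet A) :
      Measurable fun ω => (N ω).restrict A := (measurable_restrict_measure hA).comp hN.measurable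
  have hmap : Measurable fun η : LoopConfig X => η.map (Loop.map ρ) := Measure.measurable_map _ hm
  refine integral_mul_conj_nonneg (hres hT) (hres hTp) (hmap.comp (hres hTm)) ?_ ?_ ?_
    (G := fun p => F (p.1 + p.2)) (hF.comp (measurable_fst.add measurable_snd)) hint
  -- The pair `(V, V')` is a function of the restriction to `Tp ∪ Tm`, which is disjoint from `T`.
  · have h := (hN.indepFun_restrict hT (hTp.union hTm) hdT).comp measurable_id
      ((measurable_restrict_measure hTp).prodMk (hmap.comp (measurable_restrict_measure hTm)))
    have e : (fun ω => ((N ω).restrict Tp, ((N ω).restrict Tm).map (Loop.map ρ))) =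
        fun ω => (((N ω).restrict (Tp ∪ Tm)).restrict Tp,
          (((N ω).restrict (Tp ∪ Tm)).restrict Tm).map (Loop.map ρ)) := by
      funext ω
      simp only [Measure.restrict_restrict hTp, Measure.restrict_restrict hTm,
        Set.inter_eq_self_of_subset_left (Set.subset_union_left (s := Tp) (t := Tm)),
        Set.inter_eq_self_of_subset_left (Set.subset_union_right (s := Tp) (t := Tm))]
    exact e ▸ h
  · exact (hN.indepFun_restrict hTp hTm hd).comp measurable_id hmap
  · have h := congrArg (Measure.map fun η : LoopConfig X => η.restrict Tp) hlaw
    have hmN : Measurable fun ω => image ρ (N ω) := hmap.comp hN.measurable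
    rw [Measure.map_map (measurable_restrict_measure hTp) hmN,
      Measure.map_map (measurable_restrict_measure hTp) hN.measurable] at h
    refine Eq.trans (congrArg (Measure.map · Pr) ?_) h
    funext ω
    simp only [Function.comp_apply, image, Measure.restrict_map hm hTp, hpre]

end LoopConfig

/-! ### The main theorem -/

theorem mainTheorem12 {X : Type*} [Fintype X] [MeasurableSpace X] [DiscreteMeasurableSpace X]
    (E : MarkovEnergy X)
    (Xp Xm : Set X) (hcover : Xp ∪ Xm = Set.univ)
    (ρ : X → X) (hρ : Function.Involutive ρ) (hexch : ρ '' Xp = Xm)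
    (hfix : ∀ x ∈ Xp ∩ Xm, ρ x = x)
    (hE : ∀ z : X → ℂ, E.energy (z ∘ ρ) = E.energy z)
    {Ω : Type*} [MeasurableSpace Ω] (Pr : Measure Ω) [IsProbabilityMeasure Pr]
    (α : ℝ) (hα : 0 < α) (𝓛 : Ω → LoopConfig X)
    (h𝓛 : IsPoissonProcess 𝓛 (ENNReal.ofReal α • E.loopMeasure) Pr) :
    -- equality of the conditional expectations given the configuration `Λ` induced on `Xp ∩ Xm`;
    -- both ways to localize a configuration (restriction and trace) are covered
    (∀ loc ∈ ({LoopConfig.restrictTo, LoopConfig.traceOn} :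
          Set (Set X → LoopConfig X → LoopConfig X)),
      ∀ loc₀ ∈ ({LoopConfig.restrictTo, LoopConfig.traceOn} :
          Set (Set X → LoopConfig X → LoopConfig X)),
      ∀ F : LoopConfig X → ℂ, Measurable F →
        Integrable (fun ω => F (loc Xp (𝓛 ω))) Pr →
        Integrable (fun ω => F (LoopConfig.image ρ (loc Xm (𝓛 ω)))) Pr ∧
        Pr[fun ω => F (loc Xp (𝓛 ω)) |
            MeasurableSpace.comap (fun ω => loc₀ (Xp ∩ Xm) (𝓛 ω)) inferInstance]
          =ᵐ[Pr]
        Pr[fun ω => F (LoopConfig.image ρ (loc Xm (𝓛 ω))) |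
            MeasurableSpace.comap (fun ω => loc₀ (Xp ∩ Xm) (𝓛 ω)) inferInstance]) ∧
    -- reflection positivity
    (∀ F : LoopConfig X → ℂ, Measurable F →
      (MemLp (fun ω => F (LoopConfig.restrictTo Xp (𝓛 ω))) 2 Pr →
        Integrable (fun ω => F (LoopConfig.restrictTo Xp (𝓛 ω)) *
          (starRingEnd ℂ) (F (LoopConfig.image ρ (LoopConfig.restrictTo Xm (𝓛 ω))))) Pr) ∧
      (Integrable (fun ω => F (LoopConfig.restrictTo Xp (𝓛 ω)) *
          (starRingEnd ℂ) (F (LoopConfig.image ρ (LoopConfig.restrictTo Xm (𝓛 ω))))) Pr →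
        (∫ ω, F (LoopConfig.restrictTo Xp (𝓛 ω)) *
          (starRingEnd ℂ) (F (LoopConfig.image ρ (LoopConfig.restrictTo Xm (𝓛 ω)))) ∂Pr).im = 0 ∧
        0 ≤ (∫ ω, F (LoopConfig.restrictTo Xp (𝓛 ω)) *
          (starRingEnd ℂ) (F (LoopConfig.image ρ (LoopConfig.restrictTo Xm (𝓛 ω)))) ∂Pr).re)) := by
  have hρXp : ρ ⁻¹' Xp = Xm := by rw [← hexch, hρ.image_eq_preimage_symm]
  have hX0 : ρ ⁻¹' (Xp ∩ Xm) = Xp ∩ Xm := by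
    ext x
    refine ⟨fun h => ?_, fun h => ?_⟩
    -- If `ρ x` lies in `Xp ∩ Xm`, it is fixed by `ρ`, so `x = ρ (ρ x) = ρ x`.
    · have hx := hfix _ h
      rw [hρ x] at hx
      exact hx ▸ h
    · rwa [Set.mem_preimage, hfix x h]
  have hmeas : Measurable ρ := .of_discrete
  have hN' : IsPoissonProcess (fun ω => LoopConfig.image ρ (𝓛 ω))
      (ENNReal.ofReal α • E.loopMeasure) Pr := by
    have h := h𝓛.map (Loop.measurable_map hmeas)
    rwa [Measure.map_smul, E.loopMeasure_map hρ (E.P_comp_eq hρ hE)] at h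
  have hlaw : Pr.map 𝓛 = Pr.map fun ω => LoopConfig.image ρ (𝓛 ω) := h𝓛.map_eq hN'
  refine ⟨?_, fun F hF => ⟨fun h2 => ?_, fun hint => ?_⟩⟩
  · have key : ∀ loc loc₀ : Set X → LoopConfig X → LoopConfig X,
        (∀ D, Measurable (loc D)) → (∀ D, Measurable (loc₀ D)) →
        (∀ η, loc Xp (LoopConfig.image ρ η) = LoopConfig.image ρ (loc (ρ ⁻¹' Xp) η)) →
        (∀ η, loc₀ (Xp ∩ Xm) (LoopConfig.image ρ η) = loc₀ (Xp ∩ Xm) η) →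
        ∀ F : LoopConfig X → ℂ, Measurable F →
          Integrable (fun ω => F (loc Xp (𝓛 ω))) Pr →
          Integrable (fun ω => F (LoopConfig.image ρ (loc Xm (𝓛 ω)))) Pr ∧
          Pr[fun ω => F (loc Xp (𝓛 ω)) |
              MeasurableSpace.comap (fun ω => loc₀ (Xp ∩ Xm) (𝓛 ω)) inferInstance]
            =ᵐ[Pr]
          Pr[fun ω => F (LoopConfig.image ρ (loc Xm (𝓛 ω))) |
              MeasurableSpace.comap (fun ω => loc₀ (Xp ∩ Xm) (𝓛 ω)) inferInstance] := by
      intro loc loc₀ hloc hloc₀ hXp hinv F hF hint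
      -- Compare the process with its reflection through the functional `F ∘ loc Xp`.
      have h := condExp_eq_of_map_eq h𝓛.measurable hN'.measurable hlaw (hloc₀ (Xp ∩ Xm))
        (fun ω => hinv (𝓛 ω)) (hF.comp (hloc Xp)) hint
      simpa only [Function.comp_apply, hXp, hρXp] using h
    have mR : ∀ D : Set X, Measurable (LoopConfig.restrictTo D) :=
      fun D => LoopConfig.measurable_restrictTo .of_discrete
    have mT : ∀ D : Set X, Measurable (LoopConfig.traceOn D) :=
      fun D => LoopConfig.measurable_traceOn .of_discrete
    have iR : ∀ (D : Set X) η, LoopConfig.restrictTo D (LoopConfig.image ρ η) =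
        LoopConfig.image ρ (LoopConfig.restrictTo (ρ ⁻¹' D) η) :=
      fun D => LoopConfig.restrictTo_image hmeas .of_discrete
    have iT : ∀ (D : Set X) η, LoopConfig.traceOn D (LoopConfig.image ρ η) =
        LoopConfig.image ρ (LoopConfig.traceOn (ρ ⁻¹' D) η) :=
      fun D => LoopConfig.traceOn_image hmeas .of_discrete
    have fR : ∀ η, LoopConfig.restrictTo (Xp ∩ Xm) (LoopConfig.image ρ η) =
        LoopConfig.restrictTo (Xp ∩ Xm) η := fun η => by
      rw [iR, hX0, LoopConfig.image_restrictTo_eq_self .of_discrete hfix]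
    have fT : ∀ η, LoopConfig.traceOn (Xp ∩ Xm) (LoopConfig.image ρ η) =
        LoopConfig.traceOn (Xp ∩ Xm) η := fun η => by
      rw [iT, hX0, LoopConfig.image_traceOn_eq_self .of_discrete hfix]
    rintro loc (rfl | rfl) loc₀ (rfl | rfl)
    · exact key _ _ mR mR (iR Xp) fR
    · exact key _ _ mR mT (iR Xp) fT
    · exact key _ _ mT mR (iT Xp) fR
    · exact key _ _ mT mT (iT Xp) fT
  · have hG : Measurable fun η : LoopConfig X => F (LoopConfig.restrictTo Xp η) :=
      hF.comp (LoopConfig.measurable_restrictTo .of_discrete)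
    -- Both factors have the same law, so both are square integrable and their product is
    -- integrable.
    have h2' : MemLp (fun ω => F (LoopConfig.image ρ (LoopConfig.restrictTo Xm (𝓛 ω)))) 2 Pr := by
      have h : MemLp (fun η : LoopConfig X => F (LoopConfig.restrictTo Xp η)) 2 (Pr.map 𝓛) :=
        (memLp_map_measure_iff hG.aestronglyMeasurable h𝓛.measurable.aemeasurable).2 h2
      rw [hlaw, memLp_map_measure_iff hG.aestronglyMeasurable hN'.measurable.aemeasurable] at h
      simpa only [Function.comp_def, LoopConfig.restrictTo_image hmeas .of_discrete, hρXp] using h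
    exact h2.integrable_mul h2'.star
  · exact LoopConfig.reflection_positivity hρXp hfix hX0 h𝓛 hlaw.symm hF hint
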